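/- Let $G=(V,E)$ be a finite, simple, connected undirected graph. In the concurrent cops-and-robber game with $K\ge 1$ cops, started at given positions, in each round $t=1,2,\dots$ all cops and the robber simultaneously move to a vertex of the closed neighborhood of their current vertex (an illegal move is ignored). The robber is captured if, at some time $t\ge 0$, a cop is on his vertex, or if in some round he and a cop exchange their vertices (he is then placed on the vertex he was leaving); after a capture nothing moves. Both players observe the whole history of positions and use randomized, history-dependent strategies. Let $\tilde c(G)$ be the smallest $K\ge 1$ such that, from every initial position, the cops have a strategy that captures the robber with probability one against every robber strategy. Consider one cop. Let $\widetilde Q((x,y),u,w)$ be the position that follows $(x,y)$ when the cop plays $u\in V$ and the robber plays $w\in V$, and let $r(x,y)=1$ if $x\ne y$ and $r(x,y)=0$ if $x=y$. For a real matrix $(A_{u,w})_{u,w\in V}$ let $\mathbf{Val}[A_{u,w}]$ be the mixed-strategy value of the zero-sum game in which the cop chooses $u$ to minimize and the robber chooses $w$ to maximize. For $k\in\{0,1\}$ let $\Gamma^{k}_{(x,y)}$ be the game started at $(x_0,y_0)=(x,y)$ with payoff $\mathbb E\big(\sum_{t=k}^{\infty} r(x_t,y_t)\big)$, minimized by the cop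 and maximized by the robber. (For $k=0$ the payoff is the expected capture time; for $k=1$ the initial position is not counted.) Put $$\rho_0((x,y),u,w)=r(x,y),\qquad \rho_1((x,y),u,w)=r\big(\widetilde Q((x,y),u,w)\big).$$ **Theorem.** Suppose that $\tilde c(G)=1$, and let $k\in\{0,1\}$. Then for every $(x,y)\in V^2$ the game $\Gamma^{k}_{(x,y)}$ has a finite value $\hat v_{(x,y)}$ (its $\inf\sup$ and its $\sup\inf$ over the strategies of the two players coincide), and $(\hat v_{(x,y)})_{(x,y)\in V^2}$ is the componentwise smallest nonnegative real solution $v$ of the optimality equations $$v_{(x,y)}=\mathbf{Val}\big[\rho_k((x,y),u,w)+v_{\widetilde Q((x,y),u,w)}\big]\ \text{ for } x\ne y,\qquad v_{(x,y)}=0\ \text{ for } x=y.$$ Moreover, for all real initial values $v_{(x,y)}(0)\ge 0$ with $v_{(x,x)}(0)=0$, the value iteration $$v_{(x,y)}(n+1)=\mathbf{Val}\big[\rho_k((x,y),u,w)+v_{\widetilde Q((x,y),u,w)}(n)\big]\ \text{ for } x\ne y,\qquad v_{(x,x)}(n+1)=0,$$ satisfies $\lim_{n\to\infty}v_{(x,y)}(n)=\hat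 v_{(x,y)}$ for all $(x,y)\in V^2$. -/

import Mathlib

open MeasureTheory ProbabilityTheory Filter Topology
open scoped ENNReal

namespace CCCR

noncomputable section

/-! ### Positions -/

/-- A game position: the location `cop` of the cop (or the vector of locations of all cops) and the
location `robber` of the robber. -/
@[ext]
structure Position (X V : Type*) where
  cop : X
  robber : V

/-- Positions carry the discrete σ-algebra. -/
instance {X V : Type*} : MeasurableSpace (Position X V) := ⊤

instance {X V : Type*} : DiscreteMeasurableSpace (Position X V) := ⟨fun _ => trivial⟩

instance {X V : Type*} [Finite X] [Finite V] : Finite (Position X V) :=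
  Finite.of_injective (fun s : Position X V => (s.cop, s.robber)) (by
    rintro ⟨a, b⟩ ⟨c, d⟩ h
    simpa using h)

/-! ### Randomized strategies and the law of the play -/

/-- A randomized strategy: for every time `t` and every history of positions at times `0, …, t`, a
probability distribution on the moves in `M`. -/
def Strategy (S M : Type*) : Type _ :=
  (t : ℕ) → (Finset.Iic t → S) → PMF M

section Play

variable {S A B : Type*} [MeasurableSpace S] [DiscreteMeasurableSpace S] [Finite S]

/-- The conditional law of the position at time `t + 1` given the positions at times `0, …, t`: the
two players draw their moves independently of each other from their strategies, and the transition
function `Q` gives the new position. -/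
def stepKernel (Q : S → A → B → S) (πC : Strategy S A) (πR : Strategy S B) (t : ℕ) :
    Kernel (Finset.Iic t → S) S where
  toFun h := ((πC t h).bind fun a =>
    (πR t h).map fun b => Q (h ⟨t, Finset.mem_Iic.2 le_rfl⟩) a b).toMeasure
  measurable' := Measurable.of_discrete

instance (Q : S → A → B → S) (πC : Strategy S A) (πR : Strategy S B) (t : ℕ) :
    IsMarkovKernel (stepKernel Q πC πR t) :=
  ⟨fun h => by
    change IsProbabilityMeasure (PMF.toMeasure _)
    infer_instance⟩

/-- The law of the infinite sequence of positions of the game that starts at `s₀`, when the players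
use the strategies `πC` and `πR`. -/
def playLaw (Q : S → A → B → S) (s₀ : S) (πC : Strategy S A) (πR : Strategy S B) :
    Measure (ℕ → S) :=
  Kernel.traj (X := fun _ => S) (stepKernel Q πC πR) 0 (fun _ => s₀)

end Play

/-! ### Rules of the game -/

variable {V : Type*}

open Classical in
/-- The location reached from `x` by the move `x'`: this is `x'` when `x'` is in the closed
neighborhood of `x`; otherwise the move is illegal and is ignored. -/
def moveTo (G : SimpleGraph V) (x x' : V) : V :=
  if x' = x ∨ G.Adj x x' then x' else x

open Classical in
/-- The transition function with one cop: after a capture nothing moves; if the two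
tokens exchange their places, the robber is captured en passant, at his old location. -/
def nextPos (G : SimpleGraph V) (s : Position V V) (u w : V) : Position V V :=
  if s.cop = s.robber then s
  else if moveTo G s.cop u = s.robber ∧ moveTo G s.robber w = s.cop then ⟨s.robber, s.robber⟩
  else ⟨moveTo G s.cop u, moveTo G s.robber w⟩

/-- With `K` cops, the robber is captured when some cop is at his location. -/
def Captured {K : ℕ} (s : Position (Fin K → V) V) : Prop :=
  ∃ i, s.cop i = s.robber

open Classical in
/-- The transition function with `K` cops: after a capture nothing moves; if some
cop and the robber exchange their places, the robber is captured en passant, at his old location. -/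
def nextPosK (G : SimpleGraph V) {K : ℕ} (s : Position (Fin K → V) V) (u : Fin K → V) (w : V) :
    Position (Fin K → V) V :=
  if Captured s then s
  else if ∃ i, moveTo G (s.cop i) (u i) = s.robber ∧ moveTo G s.robber w = s.cop i then
    ⟨fun i => moveTo G (s.cop i) (u i), s.robber⟩
  else ⟨fun i => moveTo G (s.cop i) (u i), moveTo G s.robber w⟩

/-! ### The concurrent cop number -/

/-- `K` cops suffice: for every initial position the cop player has a strategy that captures the
robber with probability one against every strategy of the robber. -/
def CopsSuffice [Finite V] (G : SimpleGraph V) (K : ℕ) : Prop :=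
  ∀ s₀ : Position (Fin K → V) V, ∃ πC : Strategy (Position (Fin K → V) V) (Fin K → V),
    ∀ πR : Strategy (Position (Fin K → V) V) V,
      playLaw (nextPosK G) s₀ πC πR {ω | ∃ t, Captured (ω t)} = 1

/-- The concurrent cop number: the smallest number `K ≥ 1` of cops that suffices. -/
def concurrentCopNumber [Finite V] (G : SimpleGraph V) : ℕ :=
  sInf {K | 1 ≤ K ∧ CopsSuffice G K}

/-! ### Payoff and value of the game with one cop -/

open Classical in
/-- The payment `r(x, y)`: one unit if the robber is free, and nothing otherwise. -/
def reward (s : Position V V) : ℝ :=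
  if s.cop = s.robber then 0 else 1

/-- The expected value of `∑_{t ≥ k} r(x_t, y_t)` when the game starts at `s₀`.
For `k = 0` this is the expected capture time; for `k = 1` it is the expected amount that is paid in
the rounds `1, 2, …`, so that the initial position does not contribute. -/
def payoff [Finite V] (G : SimpleGraph V) (k : ℕ) (s₀ : Position V V)
    (πC πR : Strategy (Position V V) V) : ℝ≥0∞ :=
  ∫⁻ ω, ∑' t, ENNReal.ofReal (reward (ω (k + t))) ∂(playLaw (nextPos G) s₀ πC πR)

/-- `a` is the value of the game that starts at `s₀` and has the payoff `payoff G k`, which the cop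
minimizes and the robber maximizes: the upper and the lower value both exist and equal `a`. -/
def IsGameValue [Finite V] (G : SimpleGraph V) (k : ℕ) (s₀ : Position V V) (a : ℝ≥0∞) : Prop :=
  (⨅ πC, ⨆ πR, payoff G k s₀ πC πR) = a ∧ (⨆ πR, ⨅ πC, payoff G k s₀ πC πR) = a

/-! ### Matrix games -/

/-- The value of the finite zero-sum game with payoff matrix `M` in mixed strategies, where the
minimizing player chooses `u` and the maximizing player chooses `w`. -/
def matrixValue {I J : Type*} [Fintype I] [Fintype J] (M : I → J → ℝ) : ℝ :=
  ⨆ q : stdSimplex ℝ J, ⨅ p : stdSimplex ℝ I, ∑ u, ∑ w, p.1 u * q.1 w * M u w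

open Classical in
/-- The right-hand side of the optimality equations, as an operator on real functions of the
position; `ρ s s'` is the payment for the round that leads from `s` to `s'`. -/
def shapley [Fintype V] (G : SimpleGraph V) (ρ : Position V V → Position V V → ℝ)
    (v : Position V V → ℝ) (s : Position V V) : ℝ :=
  if s.cop = s.robber then 0
  else matrixValue fun u w : V => ρ s (nextPos G s u w) + v (nextPos G s u w)

end

end CCCR

open CCCR

/-! Let S be the one-round minimax operator without payments and T v = r + S v. Both are monotone,
and T^n 0 is increasing in n; it is what the robber can secure in n rounds. The crux is that T^n 0
stays bounded. The functions S^n r decrease to a fixed point p of S with 0 ≤ p ≤ r. If the robber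
always plays an optimal action of the matrix game for p, then p along the play is a submartingale
against every cop strategy, so he is still free at time n with probability at least p. Against a cop
strategy that captures almost surely this forces p = 0 (`eq_zero_of_survival_eq`). By finiteness S^N
r ≤ 1/2 for some N, and so m = max T^n 0 satisfies m ≤ N + m/2 (`exists_captureTime_iterate_le`).
Hence T^n 0 converges to a fixed point v. Stationary optimal actions for v let the cop hold the
payoff to v, and backward induction gives the robber each T^n 0, so v is the value. Any nonnegative
fixed point v' has T^n 0 ≤ T^n v' = v', so v is the least one. Value iteration is squeezed between
T^n 0 and T^n ((1 + B) v), and the latter tends to v geometrically because r ≥ v / C. The case k = 1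
is the case k = 0 conjugated by the translation v ↦ r + v. -/

namespace CCCR

/-! ### Values of finite matrix games. -/

section MatrixGame

variable {I J : Type*} [Fintype I] [Fintype J]

/-- The mixed extension of a matrix game. -/
def mixedPayoff (M : I → J → ℝ) (p : I → ℝ) (q : J → ℝ) : ℝ :=
  ∑ u, ∑ w, p u * q w * M u w

lemma mixedPayoff_eq_left (M : I → J → ℝ) (p : I → ℝ) (q : J → ℝ) :
    mixedPayoff M p q = ∑ u, p u * ∑ w, q w * M u w := by
  simp only [mixedPayoff, Finset.mul_sum, mul_assoc]

lemma mixedPayoff_eq_right (M : I → J → ℝ) (p : I → ℝ) (q : J → ℝ) :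
    mixedPayoff M p q = ∑ w, q w * ∑ u, p u * M u w := by
  rw [mixedPayoff, Finset.sum_comm]
  simp only [Finset.mul_sum]
  exact Finset.sum_congr rfl fun _ _ => Finset.sum_congr rfl fun _ _ => by ring

lemma sum_mul_le_of_mem_stdSimplex {p f : I → ℝ} {c : ℝ} (hp : p ∈ stdSimplex ℝ I)
    (h : ∀ u, f u ≤ c) : ∑ u, p u * f u ≤ c := by
  calc ∑ u, p u * f u ≤ ∑ u, p u * c :=
        Finset.sum_le_sum fun u _ => mul_le_mul_of_nonneg_left (h u) (hp.1 u)
    _ = c := by rw [← Finset.sum_mul, hp.2, one_mul]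

lemma le_sum_mul_of_mem_stdSimplex {p f : I → ℝ} {c : ℝ} (hp : p ∈ stdSimplex ℝ I)
    (h : ∀ u, c ≤ f u) : c ≤ ∑ u, p u * f u := by
  calc c = ∑ u, p u * c := by rw [← Finset.sum_mul, hp.2, one_mul]
    _ ≤ ∑ u, p u * f u :=
        Finset.sum_le_sum fun u _ => mul_le_mul_of_nonneg_left (h u) (hp.1 u)

lemma stdSimplex_nonempty [Nonempty I] : (stdSimplex ℝ I).Nonempty := by
  classical
  exact ⟨_, single_mem_stdSimplex ℝ (Classical.arbitrary I)⟩

lemma bddBelow_mixedPayoff (M : I → J → ℝ) (q : J → ℝ) :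
    BddBelow (Set.range fun p : stdSimplex ℝ I => mixedPayoff M p.1 q) := by
  obtain ⟨c, hc⟩ := (Set.finite_range fun u => ∑ w, q w * M u w).bddBelow
  refine ⟨c, ?_⟩
  rintro _ ⟨p, rfl⟩
  simp only [mixedPayoff_eq_left]
  exact le_sum_mul_of_mem_stdSimplex p.2 fun u => hc ⟨u, rfl⟩

/-- Weak duality: the value is a sup-inf, so one mixed action of the minimizer certifies an upper
bound without the minimax theorem. -/
lemma matrixValue_le [Nonempty J] {M : I → J → ℝ} {c : ℝ} {p : I → ℝ}
    (hp : p ∈ stdSimplex ℝ I) (h : ∀ w, ∑ u, p u * M u w ≤ c) : matrixValue M ≤ c := by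
  have : Nonempty (stdSimplex ℝ J) := stdSimplex_nonempty.to_subtype
  refine ciSup_le fun q => (ciInf_le (bddBelow_mixedPayoff M q.1) ⟨p, hp⟩).trans ?_
  rw [mixedPayoff_eq_right]
  exact sum_mul_le_of_mem_stdSimplex q.2 h

lemma le_matrixValue [Nonempty I] {M : I → J → ℝ} {c : ℝ} {q : J → ℝ}
    (hq : q ∈ stdSimplex ℝ J) (h : ∀ u, c ≤ ∑ w, q w * M u w) : c ≤ matrixValue M := by
  have : Nonempty (stdSimplex ℝ I) := stdSimplex_nonempty.to_subtype
  -- A real supremum is a junk value when unbounded; any fixed `p` bounds all the infima.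
  have hbdd : BddAbove (Set.range fun q : stdSimplex ℝ J =>
      ⨅ p : stdSimplex ℝ I, mixedPayoff M p.1 q.1) := by
    obtain ⟨p⟩ := (inferInstance : Nonempty (stdSimplex ℝ I))
    obtain ⟨b, hb⟩ := (Set.finite_range fun w => ∑ u, p.1 u * M u w).bddAbove
    refine ⟨b, ?_⟩
    rintro _ ⟨q, rfl⟩
    refine (ciInf_le (bddBelow_mixedPayoff M q.1) p).trans ?_
    rw [mixedPayoff_eq_right]
    exact sum_mul_le_of_mem_stdSimplex q.2 fun w => hb ⟨w, rfl⟩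
  refine le_trans (le_ciInf fun p => ?_) (le_ciSup hbdd ⟨q, hq⟩)
  rw [mixedPayoff_eq_left]
  exact le_sum_mul_of_mem_stdSimplex p.2 h

lemma convexOn_concaveOn_mixedPayoff (M : I → J → ℝ) :
    (∀ q, ConvexOn ℝ (stdSimplex ℝ I) fun p => mixedPayoff M p q) ∧
      ∀ p, ConcaveOn ℝ (stdSimplex ℝ J) fun q => mixedPayoff M p q := by
  refine ⟨fun q => ⟨convex_stdSimplex ℝ I, fun x _ y _ a b _ _ _ => le_of_eq ?_⟩,
    fun p => ⟨convex_stdSimplex ℝ J, fun x _ y _ a b _ _ _ => le_of_eq ?_⟩⟩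
  · simp only [mixedPayoff_eq_left, Pi.add_apply, Pi.smul_apply, smul_eq_mul, Finset.mul_sum,
      ← Finset.sum_add_distrib]
    exact Finset.sum_congr rfl fun _ _ => Finset.sum_congr rfl fun _ _ => by ring
  · simp only [mixedPayoff, Pi.add_apply, Pi.smul_apply, smul_eq_mul, Finset.mul_sum,
      ← Finset.sum_add_distrib]
    exact Finset.sum_congr rfl fun _ _ => Finset.sum_congr rfl fun _ _ => by ring

/-- The minimax theorem: both players have optimal mixed actions in a matrix game. -/
theorem exists_optimal [Nonempty I] [Nonempty J] (M : I → J → ℝ) :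
    (∃ p ∈ stdSimplex ℝ I, ∀ w, ∑ u, p u * M u w ≤ matrixValue M) ∧
      ∃ q ∈ stdSimplex ℝ J, ∀ u, matrixValue M ≤ ∑ w, q w * M u w := by
  classical
  obtain ⟨a, ha, b, hb, hab⟩ := Sion.exists_isSaddlePointOn (f := mixedPayoff M)
    (stdSimplex_nonempty (I := I)) (convex_stdSimplex ℝ I) (isCompact_stdSimplex ℝ I)
    (fun q _ => Continuous.lowerSemicontinuous (by unfold mixedPayoff; fun_prop)
      |>.lowerSemicontinuousOn _)
    (fun q _ => ((convexOn_concaveOn_mixedPayoff M).1 q).quasiconvexOn)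
    (convex_stdSimplex ℝ J) (stdSimplex_nonempty (I := J)) (isCompact_stdSimplex ℝ J)
    (fun p _ => Continuous.upperSemicontinuous (by unfold mixedPayoff; fun_prop)
      |>.upperSemicontinuousOn _)
    (fun p _ => ((convexOn_concaveOn_mixedPayoff M).2 p).quasiconcaveOn)
  -- The saddle point is tested against the vertices of the simplices, i.e. the pure actions; the
  -- two certificates above then identify its payoff with `matrixValue M`.
  have hleft : ∀ w, ∑ u, a u * M u w ≤ mixedPayoff M a b := fun w => by
    simpa [mixedPayoff_eq_right, Pi.single_apply] using
      hab a ha _ (single_mem_stdSimplex ℝ w)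
  have hright : ∀ u, mixedPayoff M a b ≤ ∑ w, b w * M u w := fun u => by
    simpa [mixedPayoff_eq_left, Pi.single_apply] using
      hab _ (single_mem_stdSimplex ℝ u) b hb
  exact ⟨⟨a, ha, fun w => (hleft w).trans (le_matrixValue hb hright)⟩,
    ⟨b, hb, fun u => (matrixValue_le ha hleft).trans (hright u)⟩⟩

variable [Nonempty I] [Nonempty J]

/-- The value of a matrix game increases by at most `c` when the entries increase by at most `c`. -/
lemma matrixValue_le_add {M N : I → J → ℝ} {c : ℝ} (h : ∀ u w, M u w ≤ N u w + c) :
    matrixValue M ≤ matrixValue N + c := by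
  -- An optimal action for `N` is used in `M`.
  obtain ⟨p, hp, hpN⟩ := (exists_optimal N).1
  refine matrixValue_le hp fun w => ?_
  calc ∑ u, p u * M u w ≤ ∑ u, p u * (N u w + c) :=
        Finset.sum_le_sum fun u _ => mul_le_mul_of_nonneg_left (h u w) (hp.1 u)
    _ = ∑ u, p u * N u w + c := by
        simp only [mul_add, Finset.sum_add_distrib, ← Finset.sum_mul, hp.2, one_mul]
    _ ≤ matrixValue N + c := by gcongr; exact hpN w

lemma matrixValue_mono {M N : I → J → ℝ} (h : ∀ u w, M u w ≤ N u w) :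
    matrixValue M ≤ matrixValue N := by
  simpa using matrixValue_le_add (c := 0) (by simpa using h)

lemma matrixValue_const_add (c : ℝ) (M : I → J → ℝ) :
    matrixValue (fun u w => c + M u w) = c + matrixValue M := by
  apply le_antisymm
  · rw [add_comm]
    exact matrixValue_le_add fun u w => (add_comm _ _).le
  · have := matrixValue_le_add (M := M) (N := fun u w => c + M u w) (c := -c)
      fun u w => by simp
    linarith

lemma matrixValue_const_mul_le {c : ℝ} (hc : 0 ≤ c) (M : I → J → ℝ) :
    matrixValue (fun u w => c * M u w) ≤ c * matrixValue M := by
  obtain ⟨p, hp, hpM⟩ := (exists_optimal M).1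
  refine matrixValue_le hp fun w => ?_
  calc ∑ u, p u * (c * M u w) = c * ∑ u, p u * M u w := by
        rw [Finset.mul_sum]; exact Finset.sum_congr rfl fun _ _ => by ring
    _ ≤ c * matrixValue M := mul_le_mul_of_nonneg_left (hpM w) hc

lemma matrixValue_nonneg {M : I → J → ℝ} (h : ∀ u w, 0 ≤ M u w) : 0 ≤ matrixValue M := by
  obtain ⟨q, hq⟩ := stdSimplex_nonempty (I := J)
  exact le_matrixValue hq fun u => le_sum_mul_of_mem_stdSimplex hq fun w => h u w

lemma matrixValue_le_const {M : I → J → ℝ} {c : ℝ} (h : ∀ u w, M u w ≤ c) :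
    matrixValue M ≤ c := by
  obtain ⟨p, hp⟩ := stdSimplex_nonempty (I := I)
  exact matrixValue_le hp fun w => sum_mul_le_of_mem_stdSimplex hp fun u => h u w

/-- The value of a matrix game depends continuously on the entries. -/
lemma tendsto_matrixValue {Mn : ℕ → I → J → ℝ} {M : I → J → ℝ}
    (h : ∀ u w, Tendsto (fun n => Mn n u w) atTop (𝓝 (M u w))) :
    Tendsto (fun n => matrixValue (Mn n)) atTop (𝓝 (matrixValue M)) := by
  rw [Metric.tendsto_atTop']
  intro ε hε
  have hev : ∀ᶠ n in atTop, ∀ u w, |Mn n u w - M u w| < ε / 2 :=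
    eventually_all.2 fun u => eventually_all.2 fun w =>
      (Metric.tendsto_nhds.1 (h u w) (ε / 2) (half_pos hε))
  obtain ⟨N, hN⟩ := eventually_atTop.1 hev
  refine ⟨N, fun n hn => ?_⟩
  have h₁ : matrixValue (Mn n) ≤ matrixValue M + ε / 2 :=
    matrixValue_le_add fun u w => by linarith [(abs_lt.1 (hN n hn.le u w)).2]
  have h₂ : matrixValue M ≤ matrixValue (Mn n) + ε / 2 :=
    matrixValue_le_add fun u w => by linarith [(abs_lt.1 (hN n hn.le u w)).1]
  rw [Real.dist_eq, abs_lt]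
  constructor <;> linarith

end MatrixGame

/-! ### The law of the play and potential inequalities along it. -/

section PlayLaw

variable {S A B : Type*} [MeasurableSpace S] [DiscreteMeasurableSpace S] [Finite S]

/-- The current position, that is, the last entry of a history. -/
def lastPos {t : ℕ} (h : Finset.Iic t → S) : S := h ⟨t, Finset.mem_Iic.2 le_rfl⟩

/-- The randomized strategy that looks at the time and the current position only. -/
def markovStrategy {M : Type*} (σ : ℕ → S → PMF M) : Strategy S M :=
  fun t h => σ t (lastPos h)

omit [Finite S] in
lemma measurable_comp_eval (f : S → ℝ≥0∞) (t : ℕ) : Measurable fun ω : ℕ → S => f (ω t) :=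
  Measurable.of_discrete.comp (measurable_pi_apply t)

lemma measurable_comp_eval₂ (f : S → S → ℝ≥0∞) (t t' : ℕ) :
    Measurable fun ω : ℕ → S => f (ω t) (ω t') := by
  have h : Measurable fun x : S × S => f x.1 x.2 := Measurable.of_discrete
  have h' : Measurable fun ω : ℕ → S => (ω t, ω t') :=
    (measurable_pi_apply t).prodMk (measurable_pi_apply t')
  exact h.comp h'

instance (Q : S → A → B → S) (s₀ : S) (πC : Strategy S A) (πR : Strategy S B) :
    IsProbabilityMeasure (playLaw Q s₀ πC πR) := by
  unfold playLaw; infer_instance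

lemma lintegral_playLaw_zero (Q : S → A → B → S) (s₀ : S) (πC : Strategy S A)
    (πR : Strategy S B) (f : S → ℝ≥0∞) :
    ∫⁻ ω, f (ω 0) ∂playLaw Q s₀ πC πR = f s₀ := by
  rw [playLaw, Kernel.lintegral_traj _ (measurable_comp_eval f 0)]
  simp [Function.updateFinset]

/-- Conditioning on the history up to time `t`. -/
lemma lintegral_playLaw_succ (Q : S → A → B → S) (s₀ : S) (πC : Strategy S A)
    (πR : Strategy S B) (t : ℕ) (f : S → S → ℝ≥0∞) :
    ∫⁻ ω, f (ω t) (ω (t + 1)) ∂playLaw Q s₀ πC πR =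
      ∫⁻ ω, ∫⁻ s, f (ω t) s ∂stepKernel Q πC πR t (Preorder.frestrictLe t ω)
        ∂playLaw Q s₀ πC πR := by
  have hmeas := measurable_comp_eval₂ f t (t + 1)
  have hR : ∫⁻ ω, ∫⁻ s, f (ω t) s ∂stepKernel Q πC πR t (Preorder.frestrictLe t ω)
        ∂playLaw Q s₀ πC πR =
      ∫⁻ h, ∫⁻ s, f (lastPos h) s ∂stepKernel Q πC πR t h
        ∂Kernel.partialTraj (X := fun _ => S) (stepKernel Q πC πR) 0 t (fun _ => s₀) := by
    rw [← Kernel.traj_map_frestrictLe_apply,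
      lintegral_map Measurable.of_discrete (Preorder.measurable_frestrictLe t)]
    rfl
  -- The play is the history up to `t` followed by its continuation, under which coordinate `t` is
  -- fixed and coordinate `t + 1` has law `stepKernel`.
  rw [hR, playLaw, ← Kernel.traj_comp_partialTraj (X := fun _ => S) (Nat.zero_le t),
    Kernel.lintegral_comp _ _ _ hmeas]
  refine lintegral_congr fun h => ?_
  rw [Kernel.lintegral_traj _ hmeas,
    ← Kernel.map_traj_succ_self (X := fun _ => S) (κ := stepKernel Q πC πR) (a := t),
    Kernel.map_apply _ (measurable_pi_apply _),
    lintegral_map Measurable.of_discrete (measurable_pi_apply _)]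
  simp [Function.updateFinset, lastPos]

lemma lintegral_stepKernel [Fintype A] [Fintype B] (Q : S → A → B → S) (πC : Strategy S A)
    (πR : Strategy S B) (t : ℕ) (h : Finset.Iic t → S) (f : S → ℝ≥0∞) :
    ∫⁻ s, f s ∂stepKernel Q πC πR t h =
      ∑ a, ∑ b, πC t h a * πR t h b * f (Q (lastPos h) a b) := by
  classical
  have := Fintype.ofFinite S
  change ∫⁻ s, f s ∂(PMF.toMeasure _) = _
  rw [lintegral_fintype]
  simp only [PMF.toMeasure_apply_singleton _ _ (MeasurableSet.singleton _), PMF.bind_apply,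
    PMF.map_apply, tsum_fintype, Finset.mul_sum]
  rw [Finset.sum_comm]
  refine Finset.sum_congr rfl fun a _ => ?_
  rw [Finset.sum_comm]
  refine Finset.sum_congr rfl fun b _ => ?_
  simp [lastPos, mul_comm]

/-- Potentials that decrease in mean along the play bound the total cost from above. -/
lemma sum_add_lintegral_le {Q : S → A → B → S} {s₀ : S} {πC : Strategy S A}
    {πR : Strategy S B} {c : S → ℝ≥0∞} {Φ : ℕ → S → ℝ≥0∞}
    (hΦ : ∀ t (h : Finset.Iic t → S),
      c (lastPos h) + ∫⁻ s, Φ (t + 1) s ∂stepKernel Q πC πR t h ≤ Φ t (lastPos h)) (n : ℕ) :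
    ∑ t ∈ Finset.range n, ∫⁻ ω, c (ω t) ∂playLaw Q s₀ πC πR +
      ∫⁻ ω, Φ n (ω n) ∂playLaw Q s₀ πC πR ≤ Φ 0 s₀ := by
  induction n with
  | zero => simp [lintegral_playLaw_zero]
  | succ n ih =>
    refine le_trans ?_ ih
    rw [Finset.sum_range_succ, add_assoc]
    gcongr
    rw [lintegral_playLaw_succ Q s₀ πC πR n fun _ s => Φ (n + 1) s, ← lintegral_add_left (measurable_comp_eval c n)]
    exact lintegral_mono fun ω => hΦ n (Preorder.frestrictLe n ω)

/-- Potentials that increase in mean along the play bound the total cost from below. -/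
lemma le_sum_add_lintegral {Q : S → A → B → S} {s₀ : S} {πC : Strategy S A}
    {πR : Strategy S B} {c : S → ℝ≥0∞} {Φ : ℕ → S → ℝ≥0∞}
    (hΦ : ∀ t (h : Finset.Iic t → S),
      Φ t (lastPos h) ≤ c (lastPos h) + ∫⁻ s, Φ (t + 1) s ∂stepKernel Q πC πR t h) (n : ℕ) :
    Φ 0 s₀ ≤ ∑ t ∈ Finset.range n, ∫⁻ ω, c (ω t) ∂playLaw Q s₀ πC πR +
      ∫⁻ ω, Φ n (ω n) ∂playLaw Q s₀ πC πR := by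
  induction n with
  | zero => simp [lintegral_playLaw_zero]
  | succ n ih =>
    refine ih.trans ?_
    rw [Finset.sum_range_succ, add_assoc]
    gcongr
    rw [lintegral_playLaw_succ Q s₀ πC πR n fun _ s => Φ (n + 1) s, ← lintegral_add_left (measurable_comp_eval c n)]
    exact lintegral_mono fun ω => hΦ n (Preorder.frestrictLe n ω)

/-- Almost surely, every step of the play is a transition of the game. -/
lemma ae_exists_transition [Fintype A] [Fintype B] (Q : S → A → B → S) (s₀ : S)
    (πC : Strategy S A) (πR : Strategy S B) :
    ∀ᵐ ω ∂playLaw Q s₀ πC πR, ∀ t, ∃ a b, ω (t + 1) = Q (ω t) a b := by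
  classical
  rw [ae_all_iff]
  intro t
  have hmeas : Measurable fun ω : ℕ → S =>
      (if ∃ a b, ω (t + 1) = Q (ω t) a b then 0 else 1 : ℝ≥0∞) :=
    measurable_comp_eval₂ (fun s s' => if ∃ a b, s' = Q s a b then 0 else 1) t (t + 1)
  have h0 : ∫⁻ ω, (if ∃ a b, ω (t + 1) = Q (ω t) a b then 0 else 1 : ℝ≥0∞)
      ∂playLaw Q s₀ πC πR = 0 := by
    rw [lintegral_playLaw_succ Q s₀ πC πR t
      fun s s' => if ∃ a b, s' = Q s a b then 0 else 1]
    refine (lintegral_congr fun ω => ?_).trans lintegral_zero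
    rw [lintegral_stepKernel]
    refine Finset.sum_eq_zero fun a _ => Finset.sum_eq_zero fun b _ => ?_
    rw [if_pos ⟨a, b, rfl⟩, mul_zero]
  filter_upwards [(lintegral_eq_zero_iff hmeas).1 h0] with ω hω
  by_contra hne
  simp [hne] at hω

/-- The distribution with the given weights, as a probability mass function. -/
noncomputable def pmfOfWeights {M : Type*} [Fintype M] (p : M → ℝ) (hp : p ∈ stdSimplex ℝ M) :
    PMF M :=
  PMF.ofFintype (fun m => ENNReal.ofReal (p m)) (by
    rw [← ENNReal.ofReal_sum_of_nonneg fun m _ => hp.1 m, hp.2, ENNReal.ofReal_one])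

lemma sum_pmfOfWeights_mul {M : Type*} [Fintype M] {p : M → ℝ} (hp : p ∈ stdSimplex ℝ M)
    {f : M → ℝ} (hf : ∀ m, 0 ≤ f m) :
    ∑ m, pmfOfWeights p hp m * ENNReal.ofReal (f m) = ENNReal.ofReal (∑ m, p m * f m) := by
  rw [ENNReal.ofReal_sum_of_nonneg fun m _ => mul_nonneg (hp.1 m) (hf m)]
  exact Finset.sum_congr rfl fun m _ => (ENNReal.ofReal_mul (hp.1 m)).symm

lemma sum_pmf_eq_one {M : Type*} [Fintype M] (p : PMF M) : ∑ m, p m = 1 := by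
  simpa using p.tsum_coe

/-- A mixed action of the first player bounds the mean potential after a step, if it does so against
every pure action of the second player. -/
lemma lintegral_stepKernel_le [Fintype A] [Fintype B] {Q : S → A → B → S} {πC : Strategy S A}
    {πR : Strategy S B} {t : ℕ} {h : Finset.Iic t → S} {f : S → ℝ≥0∞} {c : ℝ≥0∞}
    (hc : ∀ b, ∑ a, πC t h a * f (Q (lastPos h) a b) ≤ c) :
    ∫⁻ s, f s ∂stepKernel Q πC πR t h ≤ c := by
  rw [lintegral_stepKernel, Finset.sum_comm]
  calc ∑ b, ∑ a, πC t h a * πR t h b * f (Q (lastPos h) a b)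
      = ∑ b, πR t h b * ∑ a, πC t h a * f (Q (lastPos h) a b) := by
        simp only [Finset.mul_sum]
        exact Finset.sum_congr rfl fun _ _ => Finset.sum_congr rfl fun _ _ => by ring
    _ ≤ ∑ b, πR t h b * c := by gcongr with b; exact hc b
    _ = c := by rw [← Finset.sum_mul, sum_pmf_eq_one, one_mul]

lemma le_lintegral_stepKernel [Fintype A] [Fintype B] {Q : S → A → B → S} {πC : Strategy S A}
    {πR : Strategy S B} {t : ℕ} {h : Finset.Iic t → S} {f : S → ℝ≥0∞} {c : ℝ≥0∞}
    (hc : ∀ a, c ≤ ∑ b, πR t h b * f (Q (lastPos h) a b)) :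
    c ≤ ∫⁻ s, f s ∂stepKernel Q πC πR t h := by
  rw [lintegral_stepKernel]
  calc c = ∑ a, πC t h a * c := by rw [← Finset.sum_mul, sum_pmf_eq_one, one_mul]
    _ ≤ ∑ a, πC t h a * ∑ b, πR t h b * f (Q (lastPos h) a b) := by gcongr with a; exact hc a
    _ = ∑ a, ∑ b, πC t h a * πR t h b * f (Q (lastPos h) a b) := by
        simp only [Finset.mul_sum, mul_assoc]

end PlayLaw

/-! ### The one-round operators, with and without payments. -/

section Operators

variable {V : Type*}

lemma reward_nonneg (s : Position V V) : 0 ≤ reward s := by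
  unfold reward; split_ifs <;> norm_num

lemma reward_le_one (s : Position V V) : reward s ≤ 1 := by
  unfold reward; split_ifs <;> norm_num

lemma reward_of_eq {s : Position V V} (h : s.cop = s.robber) : reward s = 0 := if_pos h

lemma reward_of_ne {s : Position V V} (h : s.cop ≠ s.robber) : reward s = 1 := if_neg h

lemma nextPos_of_eq (G : SimpleGraph V) {s : Position V V} (h : s.cop = s.robber) (u w : V) :
    nextPos G s u w = s := if_pos h

/-- Turns a uniform bound into a multiple of the payment, the form on which decay of the iterates of
`survival` and the fixed-point inequality can act. -/
lemma le_mul_reward {f : Position V V → ℝ} (hf : ∀ s, s.cop = s.robber → f s = 0) {c : ℝ}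
    (hc : ∀ s, f s ≤ c) (s : Position V V) : f s ≤ c * reward s := by
  by_cases h : s.cop = s.robber
  · simp [hf s h, reward_of_eq h]
  · simpa [reward_of_ne h] using hc s

variable [Fintype V] (G : SimpleGraph V)

/-- The one-round operator without stage payments. -/
noncomputable def survival (v : Position V V → ℝ) : Position V V → ℝ :=
  shapley G (fun _ _ => 0) v

/-- The one-round operator of the capture time. -/
noncomputable def captureTime (v : Position V V → ℝ) : Position V V → ℝ :=
  shapley G (fun s _ => reward s) v

variable {G}

lemma survival_of_eq (v : Position V V → ℝ) {s : Position V V} (h : s.cop = s.robber) :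
    survival G v s = 0 := if_pos h

lemma survival_of_ne (v : Position V V → ℝ) {s : Position V V} (h : s.cop ≠ s.robber) :
    survival G v s = matrixValue fun u w => v (nextPos G s u w) := by
  simp [survival, shapley, h]

variable (G)

/-- The payment depends only on the current position, so it is a constant in the matrix game. -/
lemma captureTime_eq (v : Position V V → ℝ) (s : Position V V) :
    captureTime G v s = reward s + survival G v s := by
  have : Nonempty V := ⟨s.cop⟩
  by_cases h : s.cop = s.robber
  · simp [captureTime, shapley, h, survival_of_eq _ h, reward_of_eq h]
  · rw [survival_of_ne v h, ← matrixValue_const_add, captureTime, shapley, if_neg h]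

lemma shapley_reward_next (v : Position V V → ℝ) (s : Position V V) :
    shapley G (fun _ s' => reward s') v s = survival G (fun s' => reward s' + v s') s := by
  simp [survival, shapley]

lemma survival_mono : Monotone (survival G) := fun v v' hv s => by
  have : Nonempty V := ⟨s.cop⟩
  by_cases h : s.cop = s.robber
  · simp [survival_of_eq _ h]
  · rw [survival_of_ne _ h, survival_of_ne _ h]
    exact matrixValue_mono fun u w => hv _

lemma captureTime_mono : Monotone (captureTime G) := fun v v' hv s => by
  rw [captureTime_eq, captureTime_eq]
  gcongr
  exact survival_mono G hv s

variable {G}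

lemma survival_nonneg {v : Position V V → ℝ} (hv : 0 ≤ v) : 0 ≤ survival G v := fun s => by
  have : Nonempty V := ⟨s.cop⟩
  by_cases h : s.cop = s.robber
  · simp [survival_of_eq _ h]
  · rw [survival_of_ne _ h]
    exact matrixValue_nonneg fun u w => hv _

lemma captureTime_nonneg {v : Position V V → ℝ} (hv : 0 ≤ v) : 0 ≤ captureTime G v := fun s => by
  rw [captureTime_eq]
  exact add_nonneg (reward_nonneg s) (survival_nonneg hv s)

lemma survival_smul_le {c : ℝ} (hc : 0 ≤ c) (v : Position V V → ℝ) :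
    survival G (c • v) ≤ c • survival G v := fun s => by
  have : Nonempty V := ⟨s.cop⟩
  by_cases h : s.cop = s.robber
  · simp [survival_of_eq _ h]
  · rw [Pi.smul_apply, survival_of_ne _ h, survival_of_ne _ h]
    exact matrixValue_const_mul_le hc _

lemma survival_const_add_le {c : ℝ} (hc : 0 ≤ c) (v : Position V V → ℝ) (s : Position V V) :
    survival G (fun s' => c + v s') s ≤ c + survival G v s := by
  have : Nonempty V := ⟨s.cop⟩
  by_cases h : s.cop = s.robber
  · simpa [survival_of_eq _ h] using hc
  · rw [survival_of_ne _ h, survival_of_ne _ h, matrixValue_const_add]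

lemma survival_reward_le : survival G reward ≤ reward := fun s => by
  have : Nonempty V := ⟨s.cop⟩
  by_cases h : s.cop = s.robber
  · simp [survival_of_eq _ h, reward_of_eq h]
  · rw [survival_of_ne _ h, reward_of_ne h]
    exact matrixValue_le_const fun u w => reward_le_one _

lemma tendsto_survival {vn : ℕ → Position V V → ℝ} {v : Position V V → ℝ}
    (h : ∀ s, Tendsto (fun n => vn n s) atTop (𝓝 (v s))) (s : Position V V) :
    Tendsto (fun n => survival G (vn n) s) atTop (𝓝 (survival G v s)) := by
  have : Nonempty V := ⟨s.cop⟩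
  by_cases hs : s.cop = s.robber
  · simp [survival_of_eq _ hs]
  · simp only [survival_of_ne _ hs]
    exact tendsto_matrixValue fun u w => h _

lemma tendsto_captureTime {vn : ℕ → Position V V → ℝ} {v : Position V V → ℝ}
    (h : ∀ s, Tendsto (fun n => vn n s) atTop (𝓝 (v s))) (s : Position V V) :
    Tendsto (fun n => captureTime G (vn n) s) atTop (𝓝 (captureTime G v s)) := by
  simp only [captureTime_eq]
  exact (tendsto_survival h s).const_add _

lemma survival_iterate_smul_le {c : ℝ} (hc : 0 ≤ c) (v : Position V V → ℝ) (n : ℕ) :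
    (survival G)^[n] (c • v) ≤ c • (survival G)^[n] v := by
  induction n with
  | zero => exact le_rfl
  | succ n ih =>
    rw [Function.iterate_succ_apply', Function.iterate_succ_apply']
    exact (survival_mono G ih).trans (survival_smul_le hc _)

/-- Each round pays at most one unit; the rest is the terminal payoff `v` carried through `n` unpaid
rounds. -/
lemma captureTime_iterate_le (v : Position V V → ℝ) (n : ℕ) (s : Position V V) :
    (captureTime G)^[n] v s ≤ n + (survival G)^[n] v s := by
  induction n generalizing s with
  | zero => simp
  | succ n ih =>
    rw [Function.iterate_succ_apply', Function.iterate_succ_apply', captureTime_eq]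
    have h := (survival_mono G ih s).trans (survival_const_add_le n.cast_nonneg _ s)
    push_cast
    linarith [reward_le_one s]

/-- An optimal mixed action of the robber. -/
lemma exists_robber_action {v : Position V V → ℝ} (hv : 0 ≤ v) (s : Position V V) :
    ∃ q ∈ stdSimplex ℝ V, ∀ u, survival G v s ≤ ∑ w, q w * v (nextPos G s u w) := by
  have : Nonempty V := ⟨s.cop⟩
  by_cases h : s.cop = s.robber
  · obtain ⟨q, hq⟩ := stdSimplex_nonempty (I := V)
    refine ⟨q, hq, fun u => ?_⟩
    rw [survival_of_eq _ h]
    exact Finset.sum_nonneg fun w _ => mul_nonneg (hq.1 w) (hv _)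
  · rw [survival_of_ne _ h]
    exact (exists_optimal _).2

/-- An optimal mixed action of the cop. -/
lemma exists_cop_action {v : Position V V → ℝ} (hv : ∀ s, s.cop = s.robber → v s = 0)
    (s : Position V V) :
    ∃ p ∈ stdSimplex ℝ V, ∀ w, ∑ u, p u * v (nextPos G s u w) ≤ survival G v s := by
  have : Nonempty V := ⟨s.cop⟩
  -- After a capture the position is frozen and the mean is `v s`, hence the assumption that `v`
  -- vanishes there.
  by_cases h : s.cop = s.robber
  · obtain ⟨p, hp⟩ := stdSimplex_nonempty (I := V)
    refine ⟨p, hp, fun w => ?_⟩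
    simp [survival_of_eq _ h, nextPos_of_eq G h, hv s h]
  · rw [survival_of_ne _ h]
    exact (exists_optimal _).1

/-! ### A single cop captures almost surely -/

/-- The position of the one-cop game that corresponds to a position of the `K`-cop game with
`K = 1`. -/
def singleCop (s : Position (Fin 1 → V) V) : Position V V := ⟨s.cop 0, s.robber⟩

omit [Fintype V] in
lemma captured_iff (s : Position (Fin 1 → V) V) :
    Captured s ↔ (singleCop s).cop = (singleCop s).robber := by
  simp [Captured, singleCop]

omit [Fintype V] in
-- The two rules agree also in an exchange, where the cop's target is the robber's old location.
lemma singleCop_nextPosK (s : Position (Fin 1 → V) V) (u : Fin 1 → V) (w : V) :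
    singleCop (nextPosK G s u w) = nextPos G (singleCop s) (u 0) w := by
  by_cases h : Captured s
  · rw [nextPos_of_eq G ((captured_iff s).1 h), nextPosK, if_pos h]
  · have h' : ¬(singleCop s).cop = (singleCop s).robber := fun e => h ((captured_iff s).2 e)
    rw [nextPosK, if_neg h, nextPos, if_neg h']
    have hiff : (∃ i : Fin 1, moveTo G (s.cop i) (u i) = s.robber ∧
        moveTo G s.robber w = s.cop i) ↔ moveTo G (singleCop s).cop (u 0) = (singleCop s).robber ∧
        moveTo G (singleCop s).robber w = (singleCop s).cop := Fin.exists_fin_one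
    by_cases hx : moveTo G (singleCop s).cop (u 0) = (singleCop s).robber ∧
        moveTo G (singleCop s).robber w = (singleCop s).cop
    · rw [if_pos (hiff.2 hx), if_pos hx]
      ext
      · exact hx.1
      · rfl
    · rw [if_neg (mt hiff.1 hx), if_neg hx]
      rfl

/-- When one cop captures almost surely, no nonnegative function of the position that is bounded by
the payment is a fixed point of the operator without payments, except zero. -/
lemma eq_zero_of_survival_eq (hG : CopsSuffice G 1) {p : Position V V → ℝ} (hp : 0 ≤ p)
    (hpr : p ≤ reward) (hfix : survival G p = p) : p = 0 := by
  classical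
  funext s
  refine le_antisymm ?_ (hp s)
  choose q hq hqp using exists_robber_action (G := G) hp
  let s₀ : Position (Fin 1 → V) V := ⟨fun _ => s.cop, s.robber⟩
  obtain ⟨πC, hC⟩ := hG s₀
  let πR : Strategy (Position (Fin 1 → V) V) V :=
    markovStrategy fun _ s => pmfOfWeights (q (singleCop s)) (hq _)
  specialize hC πR
  set μ := playLaw (nextPosK G) s₀ πC πR
  let Φ : ℕ → Position (Fin 1 → V) V → ℝ≥0∞ := fun _ s => ENNReal.ofReal (p (singleCop s))
  have hms : ∀ n, MeasurableSet {ω : ℕ → Position (Fin 1 → V) V | ¬ Captured (ω n)} := by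
    intro n
    have hev : Measurable fun ω : ℕ → Position (Fin 1 → V) V => ω n := measurable_pi_apply n
    exact hev (MeasurableSet.of_discrete (s := {s | ¬ Captured s}))
  -- Submartingale bound: `p` does not decrease in mean, and it is at most the indicator of a free
  -- robber.
  have hlow : ∀ n, ENNReal.ofReal (p s) ≤ μ {ω | ¬ Captured (ω n)} := by
    intro n
    have h := le_sum_add_lintegral (Q := nextPosK G) (s₀ := s₀) (πC := πC) (πR := πR)
      (c := fun _ => 0) (Φ := Φ) (fun t h => by
        rw [zero_add]
        refine le_lintegral_stepKernel fun u => ?_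
        simp only [Φ, singleCop_nextPosK, πR, markovStrategy]
        rw [sum_pmfOfWeights_mul (hq _) fun w => hp _]
        refine ENNReal.ofReal_le_ofReal ?_
        conv_lhs => rw [← hfix]
        exact hqp _ _) n
    simp only [lintegral_zero, Finset.sum_const_zero, zero_add] at h
    refine h.trans ?_
    rw [← lintegral_indicator_one (hms n)]
    refine lintegral_mono fun ω => ?_
    by_cases hω : Captured (ω n)
    · have h0 : p (singleCop (ω n)) ≤ 0 :=
        (hpr _).trans (reward_of_eq ((captured_iff _).1 hω)).le
      simp [Φ, ENNReal.ofReal_of_nonpos h0]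
    · have h1 : p (singleCop (ω n)) ≤ 1 := (hpr _).trans (reward_le_one _)
      simpa [Φ, hω, Set.indicator] using h1
  have hcap : ∀ᵐ ω ∂μ, ∃ t, Captured (ω t) := by
    refine (mem_ae_iff_prob_eq_one ?_).2 hC
    have : {ω : ℕ → Position (Fin 1 → V) V | ∃ t, Captured (ω t)} =
        ⋃ t, {ω | ¬ Captured (ω t)}ᶜ := by ext; simp
    rw [this]
    exact MeasurableSet.iUnion fun t => (hms t).compl
  -- Captured positions are absorbing, so almost surely the robber is captured at all late times.
  have hlim : Tendsto (fun n => μ {ω | ¬ Captured (ω n)}) atTop (𝓝 (μ ∅)) := by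
    refine tendsto_measure_of_ae_tendsto_indicator_of_isFiniteMeasure _ MeasurableSet.empty hms ?_
    filter_upwards [hcap, ae_exists_transition (nextPosK G) s₀ πC πR] with ω ⟨N, hN⟩ hω
    filter_upwards [eventually_ge_atTop N] with n hn
    have : Captured (ω n) := by
      induction n, hn using Nat.le_induction with
      | base => exact hN
      | succ n _ ih =>
        obtain ⟨a, b, h⟩ := hω n
        rwa [h, nextPosK, if_pos ih]
    simpa using this
  rw [measure_empty] at hlim
  exact ENNReal.ofReal_eq_zero.1 (le_antisymm (ge_of_tendsto' hlim hlow) zero_le)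

/-- The finite-horizon capture times are bounded. -/
lemma exists_captureTime_iterate_le (hG : CopsSuffice G 1) :
    ∃ C : ℝ, ∀ n s, (captureTime G)^[n] 0 s ≤ C := by
  have hnonneg : ∀ n, (0 : Position V V → ℝ) ≤ (survival G)^[n] reward := by
    intro n
    induction n with
    | zero => exact reward_nonneg
    | succ n ih => rw [Function.iterate_succ_apply']; exact survival_nonneg ih
  have hanti : Antitone fun n => (survival G)^[n] reward :=
    (survival_mono G).antitone_iterate_of_map_le survival_reward_le
  let p : Position V V → ℝ := fun s => ⨅ n, (survival G)^[n] reward s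
  have hbdd : ∀ s, BddBelow (Set.range fun n => (survival G)^[n] reward s) := fun s =>
    ⟨0, by rintro _ ⟨n, rfl⟩; exact hnonneg n s⟩
  have hlim : ∀ s, Tendsto (fun n => (survival G)^[n] reward s) atTop (𝓝 (p s)) := fun s =>
    tendsto_atTop_ciInf (fun m n h => hanti h s) (hbdd s)
  have hp : p = 0 := by
    refine eq_zero_of_survival_eq hG (fun s => le_ciInf fun n => hnonneg n s)
      (fun s => ciInf_le (hbdd s) 0) (funext fun s => ?_)
    refine tendsto_nhds_unique (tendsto_survival hlim s) ?_
    simpa only [Function.iterate_succ_apply'] using (tendsto_add_atTop_iff_nat 1).2 (hlim s)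
  obtain ⟨N, hN⟩ : ∃ N, ∀ s, (survival G)^[N] reward s ≤ 1 / 2 := by
    have : ∀ᶠ n in atTop, ∀ s, (survival G)^[n] reward s ≤ 1 / 2 :=
      eventually_all.2 fun s => (hlim s).eventually_le_const (by simp [hp])
    exact this.exists
  -- At a maximizer `s₁` of `a`, `a s₁ ≤ N + a s₁ / 2`.
  refine ⟨2 * N, fun n s => ?_⟩
  have : Nonempty (Position V V) := ⟨s⟩
  set a : Position V V → ℝ := (captureTime G)^[n] 0 with ha
  obtain ⟨s₁, hs₁⟩ := Finite.exists_max a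
  have hmono : Monotone fun n => (captureTime G)^[n] (0 : Position V V → ℝ) :=
    (captureTime_mono G).monotone_iterate_of_le_map (captureTime_nonneg le_rfl)
  have ha0 : 0 ≤ a := hmono (Nat.zero_le n)
  have hcap : ∀ s, s.cop = s.robber → a s = 0 := by
    intro s hs
    rw [ha]
    cases n with
    | zero => rfl
    | succ n =>
      rw [Function.iterate_succ_apply', captureTime_eq, survival_of_eq _ hs, reward_of_eq hs,
        add_zero]
  have h₁ : a s₁ ≤ (captureTime G)^[N] a s₁ := by
    rw [ha, ← Function.iterate_add_apply]
    exact hmono (Nat.le_add_left n N) s₁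
  have h₂ : (survival G)^[N] a s₁ ≤ a s₁ * (survival G)^[N] reward s₁ :=
    ((survival_mono G).iterate N (le_mul_reward hcap hs₁) s₁).trans
      (survival_iterate_smul_le (ha0 s₁) reward N s₁)
  have h₃ : a s₁ * (survival G)^[N] reward s₁ ≤ a s₁ * (1 / 2) :=
    mul_le_mul_of_nonneg_left (hN s₁) (ha0 s₁)
  have h₄ := captureTime_iterate_le (G := G) a N s₁
  linarith [hs₁ s]

/-- The finite-horizon capture times converge to a fixed point. -/
lemma exists_limit_captureTime (hG : CopsSuffice G 1) :
    ∃ v : Position V V → ℝ, 0 ≤ v ∧ captureTime G v = v ∧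
      ∀ s, Tendsto (fun n => (captureTime G)^[n] 0 s) atTop (𝓝 (v s)) := by
  obtain ⟨C, hC⟩ := exists_captureTime_iterate_le hG
  have hmono : Monotone fun n => (captureTime G)^[n] (0 : Position V V → ℝ) :=
    (captureTime_mono G).monotone_iterate_of_le_map (captureTime_nonneg le_rfl)
  have hlim : ∀ s, Tendsto (fun n => (captureTime G)^[n] 0 s) atTop
      (𝓝 (⨆ n, (captureTime G)^[n] 0 s)) := fun s =>
    tendsto_atTop_ciSup (fun m n h => hmono h s) ⟨C, by rintro _ ⟨n, rfl⟩; exact hC n s⟩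
  refine ⟨_, fun s => ge_of_tendsto' (hlim s) fun n => hmono (Nat.zero_le n) s,
    funext fun s => tendsto_nhds_unique (tendsto_captureTime hlim s) ?_, hlim⟩
  simpa only [Function.iterate_succ_apply'] using (tendsto_add_atTop_iff_nat 1).2 (hlim s)

/-! ### Geometric convergence to the fixed point. -/

section Limit

variable {v : Position V V → ℝ} (hv : 0 ≤ v) (hfix : captureTime G v = v)
  (hlim : ∀ s, Tendsto (fun n => (captureTime G)^[n] 0 s) atTop (𝓝 (v s)))

include hv hfix

lemma reward_le_of_fixed : reward ≤ v := fun s => by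
  conv_rhs => rw [← hfix, captureTime_eq]
  exact le_add_of_nonneg_right (survival_nonneg hv s)

omit hv in
lemma eq_zero_of_fixed {s : Position V V} (h : s.cop = s.robber) : v s = 0 := by
  rw [← hfix, captureTime_eq, survival_of_eq _ h, reward_of_eq h, add_zero]

omit hv in
/-- Near a fixed point the operator of the capture time is a contraction in the direction of the
fixed point. -/
lemma exists_captureTime_iterate_smul_le : ∃ a : ℝ, 0 ≤ a ∧ a < 1 ∧ ∀ e : ℝ, 0 ≤ e → ∀ n,
    (captureTime G)^[n] ((1 + e) • v) ≤ (1 + e * a ^ n) • v := by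
  obtain ⟨B, hB⟩ := (Set.finite_range v).bddAbove
  -- Taking `C ≥ 1` puts the rate `1 - 1 / C` in `[0, 1)`.
  set C := max B 1
  have hC : 1 ≤ C := le_max_right _ _
  have hC0 : 0 < C := by linarith
  have hvC : ∀ s, v s ≤ C * reward s := le_mul_reward (fun s => eq_zero_of_fixed hfix)
    fun s => (hB ⟨s, rfl⟩).trans (le_max_left _ _)
  have ha : 0 ≤ 1 - 1 / C := by
    rw [sub_nonneg, div_le_one hC0]; exact hC
  refine ⟨1 - 1 / C, ha, by linarith [one_div_pos.2 hC0], ?_⟩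
  -- Since S v = v - r, one round sends (1 + e) v to at most (1 + e) v - e r, and r ≥ v / C.
  have hstep : ∀ e : ℝ, 0 ≤ e →
      captureTime G ((1 + e) • v) ≤ (1 + e * (1 - 1 / C)) • v := by
    intro e he s
    have h₁ := survival_smul_le (G := G) (show 0 ≤ 1 + e by linarith) v s
    have h₂ : v s = reward s + survival G v s := by
      conv_lhs => rw [← hfix, captureTime_eq]
    have h₃ : e * (v s / C) ≤ e * reward s :=
      mul_le_mul_of_nonneg_left ((div_le_iff₀' hC0).2 (hvC s)) he
    have h₄ : (1 + e * (1 - 1 / C)) * v s = (1 + e) * v s - e * (v s / C) := by ring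
    rw [captureTime_eq]
    simp only [Pi.smul_apply, smul_eq_mul] at h₁ ⊢
    rw [h₄]
    nlinarith
  intro e he n
  induction n with
  | zero => simp
  | succ n ih =>
    rw [Function.iterate_succ_apply']
    refine (captureTime_mono G ih).trans ((hstep _ (by positivity)).trans (le_of_eq ?_))
    rw [pow_succ, mul_assoc]

include hlim

/-- Value iteration converges from every nonnegative function that vanishes on captures. -/
lemma tendsto_captureTime_iterate {f : Position V V → ℝ} (hf : 0 ≤ f)
    (hf0 : ∀ s, s.cop = s.robber → f s = 0) (s : Position V V) :
    Tendsto (fun n => (captureTime G)^[n] f s) atTop (𝓝 (v s)) := by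
  obtain ⟨a, ha0, ha1, ha⟩ := exists_captureTime_iterate_smul_le hfix
  obtain ⟨B, hB⟩ := (Set.finite_range f).bddAbove
  have hB0 : 0 ≤ B := (hf s).trans (hB ⟨s, rfl⟩)
  have hfv : f ≤ (1 + B) • v := fun s => by
    have h₁ := le_mul_reward hf0 (fun s => hB ⟨s, rfl⟩) s
    have h₂ := mul_le_mul_of_nonneg_left (reward_le_of_fixed hv hfix s) hB0
    simp only [Pi.smul_apply, smul_eq_mul]
    have h₃ : 0 ≤ v s := hv s
    linarith
  refine tendsto_of_tendsto_of_tendsto_of_le_of_le (hlim s)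
    (h := fun n => (1 + B * a ^ n) * v s) ?_ (fun n => (captureTime_mono G).iterate n hf s)
    (fun n => ((captureTime_mono G).iterate n hfv s).trans (ha B hB0 n s))
  simpa using (((tendsto_pow_atTop_nhds_zero_of_lt_one ha0 ha1).const_mul B).const_add 1).mul_const
    (v s)

end Limit

end Operators

/-! ### Guarantees of the two players and the value. -/

section Value

variable {V : Type*} [Fintype V] {G : SimpleGraph V}

lemma payoff_eq_tsum (G : SimpleGraph V) (k : ℕ) (s₀ : Position V V)
    (πC πR : Strategy (Position V V) V) :
    payoff G k s₀ πC πR =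
      ∑' t, ∫⁻ ω, ENNReal.ofReal (reward (ω (k + t))) ∂playLaw (nextPos G) s₀ πC πR :=
  lintegral_tsum fun t =>
    (measurable_comp_eval (fun s => ENNReal.ofReal (reward s)) (k + t)).aemeasurable

/-- The initial position is deterministic, so the two payoffs differ by a constant independent of
the strategies. -/
lemma payoff_zero_eq (G : SimpleGraph V) (s₀ : Position V V)
    (πC πR : Strategy (Position V V) V) :
    payoff G 0 s₀ πC πR = ENNReal.ofReal (reward s₀) + payoff G 1 s₀ πC πR := by
  rw [payoff_eq_tsum, payoff_eq_tsum, tsum_eq_zero_add' ENNReal.summable]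
  congr 1
  · exact lintegral_playLaw_zero _ _ _ _ fun s => ENNReal.ofReal (reward s)
  · simp only [zero_add, add_comm]

/-- A stationary strategy of the cop guarantees the fixed point. -/
lemma exists_payoff_le {v : Position V V → ℝ} (hv : 0 ≤ v) (hfix : captureTime G v = v) :
    ∃ πC, ∀ s πR, payoff G 0 s πC πR ≤ ENNReal.ofReal (v s) := by
  choose p hp hpv using exists_cop_action (G := G) (v := v) fun s => eq_zero_of_fixed hfix
  refine ⟨markovStrategy fun _ s => pmfOfWeights (p s) (hp s), fun s πR => ?_⟩
  rw [payoff_eq_tsum]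
  refine ENNReal.tsum_le_of_sum_range_le fun n => ?_
  simp only [zero_add]
  -- The nonnegative remaining potential is dropped.
  refine le_self_add.trans (sum_add_lintegral_le (c := fun s => ENNReal.ofReal (reward s))
    (Φ := fun _ s => ENNReal.ofReal (v s)) (fun t h => ?_) n)
  conv_rhs => rw [← hfix, captureTime_eq,
    ENNReal.ofReal_add (reward_nonneg _) (survival_nonneg hv _)]
  gcongr
  refine lintegral_stepKernel_le fun w => ?_
  simp only [markovStrategy]
  rw [sum_pmfOfWeights_mul (hp _) fun u => hv _]
  exact ENNReal.ofReal_le_ofReal (hpv _ w)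

/-- The robber guarantees every finite-horizon capture time. -/
lemma exists_le_payoff (G : SimpleGraph V) (n : ℕ) :
    ∃ πR, ∀ s πC, ENNReal.ofReal ((captureTime G)^[n] 0 s) ≤ payoff G 0 s πC πR := by
  have h0 : ∀ n, (0 : Position V V → ℝ) ≤ (captureTime G)^[n] 0 := fun n =>
    (captureTime_mono G).monotone_iterate_of_le_map (captureTime_nonneg le_rfl) (Nat.zero_le n)
  choose q hq hqv using fun t => exists_robber_action (G := G) (h0 t)
  -- After the move at time `t`, `n - (t + 1)` rounds remain. Past the horizon the truncated
  -- difference is 0 and the potential vanishes, so any action serves.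
  refine ⟨markovStrategy fun t s => pmfOfWeights (q (n - (t + 1)) s) (hq _ s),
    fun s πC => ?_⟩
  rw [payoff_eq_tsum]
  simp only [zero_add]
  refine le_trans ?_ (ENNReal.sum_le_tsum (Finset.range n))
  have h := le_sum_add_lintegral (Q := nextPos G) (s₀ := s) (πC := πC)
    (πR := markovStrategy fun t s => pmfOfWeights (q (n - (t + 1)) s) (hq _ s))
    (c := fun s => ENNReal.ofReal (reward s))
    (Φ := fun t s => ENNReal.ofReal ((captureTime G)^[n - t] 0 s)) (fun t h => ?_) n
  · simpa using h
  · rcases Nat.lt_or_ge t n with htn | htn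
    · obtain ⟨m, rfl⟩ := Nat.exists_eq_add_of_lt htn
      have hm : t + m + 1 - t = m + 1 := by omega
      rw [hm, Function.iterate_succ_apply', captureTime_eq,
        ENNReal.ofReal_add (reward_nonneg _) (survival_nonneg (h0 m) _)]
      gcongr
      have hm' : t + m + 1 - (t + 1) = m := by omega
      refine le_lintegral_stepKernel fun u => ?_
      simp only [markovStrategy, hm']
      rw [sum_pmfOfWeights_mul (hq _ _) fun w => h0 _ _]
      exact ENNReal.ofReal_le_ofReal (hqv _ _ u)
    · simp [Nat.sub_eq_zero_of_le htn]

/-- The robber needs no optimal strategy: his finite-horizon guarantees converge to what the cop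
guarantees. -/
lemma isGameValue_zero {v : Position V V → ℝ} (hv : 0 ≤ v) (hfix : captureTime G v = v)
    (hlim : ∀ s, Tendsto (fun n => (captureTime G)^[n] 0 s) atTop (𝓝 (v s)))
    (s : Position V V) : IsGameValue G 0 s (ENNReal.ofReal (v s)) := by
  have hupper : ⨅ πC, ⨆ πR, payoff G 0 s πC πR ≤ ENNReal.ofReal (v s) := by
    obtain ⟨πC, h⟩ := exists_payoff_le hv hfix
    exact iInf_le_of_le πC (iSup_le (h s))
  have hlower : ENNReal.ofReal (v s) ≤ ⨆ πR, ⨅ πC, payoff G 0 s πC πR := by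
    refine le_of_tendsto' (ENNReal.tendsto_ofReal (hlim s)) fun n => ?_
    obtain ⟨πR, h⟩ := exists_le_payoff G n
    exact le_iSup_of_le πR (le_iInf (h s))
  have hmid : ⨆ πR, ⨅ πC, payoff G 0 s πC πR ≤ ⨅ πC, ⨆ πR, payoff G 0 s πC πR :=
    iSup_iInf_le_iInf_iSup _
  exact ⟨hupper.antisymm (hlower.trans hmid), (hmid.trans hupper).antisymm hlower⟩

/-- Dropping the payment of the initial position lowers the value by this payment. -/
lemma IsGameValue.one {v : Position V V → ℝ} (hr : reward ≤ v) {s : Position V V}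
    (h : IsGameValue G 0 s (ENNReal.ofReal (v s))) :
    IsGameValue G 1 s (ENNReal.ofReal (v s - reward s)) := by
  -- A constant leaves a supremum in `ℝ≥0∞` only over a nonempty index set.
  have : Nonempty (Strategy (Position V V) V) := ⟨fun _ _ => PMF.pure s.cop⟩
  have hv : ENNReal.ofReal (v s) =
      ENNReal.ofReal (reward s) + ENNReal.ofReal (v s - reward s) := by
    rw [← ENNReal.ofReal_add (reward_nonneg s) (sub_nonneg.2 (hr s)), add_sub_cancel]
  simp only [IsGameValue, payoff_zero_eq, ← ENNReal.add_iSup, ← ENNReal.add_iInf, hv] at h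
  exact ⟨(ENNReal.add_right_inj ENNReal.ofReal_ne_top).1 h.1,
    (ENNReal.add_right_inj ENNReal.ofReal_ne_top).1 h.2⟩

/-- `sInf ∅ = 0` in `ℕ`, so a nonzero cop number is attained. -/
lemma copsSuffice_of_concurrentCopNumber_eq {K : ℕ} (hK : K ≠ 0)
    (h : concurrentCopNumber G = K) : CopsSuffice G K := by
  have hne : {K | 1 ≤ K ∧ CopsSuffice G K}.Nonempty :=
    Nat.nonempty_of_sInf_eq_succ (k := K - 1) (h.trans (by omega))
  have := Nat.sInf_mem hne
  rw [← concurrentCopNumber, h] at this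
  exact this.2

end Value

end CCCR

open CCCR
/-- First part: the game whose payoff is the capture time `∑_{t ≥ 0} r(x_t, y_t)`; the stage payment
in the optimality equations is `r` at the current position. Second part: the game whose payoff is
`∑_{t ≥ 1} r(x_t, y_t)`; the stage payment is `r` at the next position. -/
theorem theorem4p6 {V : Type*} [Fintype V] (G : SimpleGraph V) (hG : G.Connected)
    (hc : concurrentCopNumber G = 1) :
    (∃ v : Position V V → ℝ,
      (∀ s, IsGameValue G 0 s (ENNReal.ofReal (v s))) ∧
      IsLeast {v' : Position V V → ℝ | (∀ s, 0 ≤ v' s) ∧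
        ∀ s, v' s = shapley G (fun s _ => reward s) v' s} v ∧
      ∀ vn : ℕ → Position V V → ℝ,
        (∀ s, 0 ≤ vn 0 s) → (∀ x, vn 0 ⟨x, x⟩ = 0) →
        (∀ n s, vn (n + 1) s = shapley G (fun s _ => reward s) (vn n) s) →
        ∀ s, Tendsto (fun n => vn n s) atTop (𝓝 (v s))) ∧
    (∃ v : Position V V → ℝ,
      (∀ s, IsGameValue G 1 s (ENNReal.ofReal (v s))) ∧
      IsLeast {v' : Position V V → ℝ | (∀ s, 0 ≤ v' s) ∧
        ∀ s, v' s = shapley G (fun _ s' => reward s') v' s} v ∧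
      ∀ vn : ℕ → Position V V → ℝ,
        (∀ s, 0 ≤ vn 0 s) → (∀ x, vn 0 ⟨x, x⟩ = 0) →
        (∀ n s, vn (n + 1) s = shapley G (fun _ s' => reward s') (vn n) s) →
        ∀ s, Tendsto (fun n => vn n s) atTop (𝓝 (v s))) := by
  obtain ⟨v, hv, hfix, hlim⟩ :=
    exists_limit_captureTime (copsSuffice_of_concurrentCopNumber_eq one_ne_zero hc)
  have hr := reward_le_of_fixed hv hfix
  have hleast : ∀ v' : Position V V → ℝ, 0 ≤ v' → captureTime G v' = v' → v ≤ v' :=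
    fun v' hv' hfix' s => le_of_tendsto' (hlim s) fun n => by
      have := (captureTime_mono G).iterate n hv' s
      rwa [Function.iterate_fixed hfix'] at this
  have hconv : ∀ vn : ℕ → Position V V → ℝ, (∀ s, 0 ≤ vn 0 s) → (∀ x, vn 0 ⟨x, x⟩ = 0) →
      (∀ n, vn (n + 1) = captureTime G (vn n)) →
      ∀ s, Tendsto (fun n => vn n s) atTop (𝓝 (v s)) := by
    intro vn h0 hdiag hstep s
    have hiter : ∀ n, vn n = (captureTime G)^[n] (vn 0) := fun n => by
      induction n with
      | zero => rfl
      | succ n ih => rw [hstep, Function.iterate_succ_apply', ← ih]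
    have hdiag' : ∀ s : Position V V, s.cop = s.robber → vn 0 s = 0 := by
      rintro ⟨x, y⟩ h
      obtain rfl : x = y := h
      exact hdiag x
    rw [funext fun n => congrFun (hiter n) s]
    exact tendsto_captureTime_iterate hv hfix hlim h0 hdiag' s
  -- Translation by the payment conjugates the operator for k = 1 to that for k = 0, carrying over
  -- fixed points, minimality and iterates.
  have hshift : ∀ v' : Position V V → ℝ, captureTime G (reward + v') =
      reward + shapley G (fun _ s' => reward s') v' := fun v' => funext fun s => by
    rw [captureTime_eq, Pi.add_apply, shapley_reward_next]; rfl
  refine ⟨⟨v, isGameValue_zero hv hfix hlim, ⟨⟨hv, fun s => (congrFun hfix s).symm⟩, ?_⟩, ?_⟩,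
    ⟨v - reward, fun s => (isGameValue_zero hv hfix hlim s).one hr,
      ⟨⟨fun s => sub_nonneg.2 (hr s), fun s => ?_⟩, ?_⟩, ?_⟩⟩
  · exact fun v' h => hleast v' h.1 (funext fun s => (h.2 s).symm)
  · exact fun vn h0 hdiag hstep => hconv vn h0 hdiag fun n => funext (hstep n)
  · have h := congrFun (hshift (v - reward)) s
    rw [add_sub_cancel, hfix] at h
    rw [Pi.sub_apply, h, Pi.add_apply, add_sub_cancel_left]
  · intro v' h s
    have h' := hleast (reward + v') (fun s => add_nonneg (reward_nonneg s) (h.1 s))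
      ((hshift v').trans (congrArg _ (funext fun s => (h.2 s).symm))) s
    simp only [Pi.add_apply, Pi.sub_apply] at h' ⊢
    linarith
  · intro vn h0 hdiag hstep s
    have h := hconv (fun n => reward + vn n) (fun s => add_nonneg (reward_nonneg s) (h0 s))
      (fun x => by simp [reward_of_eq, hdiag])
      (fun n => by rw [hshift]; exact congrArg _ (funext (hstep n))) s
    simpa using h.sub_const (reward s)
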